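/- Let $Q=\mathbb{C}^2$ with orthonormal basis $|0\rangle,|1\rangle$, let $|\pm\rangle=\tfrac{1}{\sqrt2}(|0\rangle\pm|1\rangle)$, and write $Q^n=Q^{\otimes n}$ (so $Q^0=\mathbb{C}$). A ZX diagram $m\to n$ is an arrow of the free self-dual compact category on the following vertices, i.e. it is built by sequential composition and by juxtaposition from them and from identity, crossing and bent wires: $Z^m_n(\alpha):m\to n$ and $X^m_n(\alpha):m\to n$ for $m,n\ge 0$ and angles $\alpha\in\mathbb{R}/2\pi\mathbb{Z}$, and $H:1\to 1$. The interpretation $[\![D]\!]:Q^m\to Q^n$ of a diagram $D:m\to n$ is the symmetric monoidal functor determined by $$[\![Z^m_n(\alpha)]\!]=|0\rangle^{\otimes n}\langle 0|^{\otimes m}+e^{i\alpha}|1\rangle^{\otimes n}\langle 1|^{\otimes m},\qquad [\![X^m_n(\alpha)]\!]=|+\rangle^{\otimes n}\langle +|^{\otimes m}+e^{i\alpha}|-\rangle^{\otimes n}\langle -|^{\otimes m},$$ $$[\![H]\!]=\tfrac{1}{\sqrt2}\begin{pmatrix}1&1\\1&-1\end{pmatrix},$$ where the wire bent to join two outputs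 is sent to $|00\rangle+|11\rangle$ and the wire bent to join two inputs to $\langle 00|+\langle 11|$. Then: 1. The Hadamard vertex represents the Hadamard gate, and $[\![Z^1_1(\alpha)]\!]=Z_\alpha=\begin{pmatrix}1&0\\0&e^{i\alpha}\end{pmatrix}$ for every $\alpha$. 2. The diagram consisting of a $Z$ vertex (angle $0$) on the first wire joined by an edge to an $X$ vertex (angle $0$) on the second wire represents the controlled-NOT gate $\wedge X$ (first qubit as control) up to a normalising scalar, whichever way the connecting edge is directed: $$[\![(\mathrm{id}_1\otimes X^2_1(0))\circ(Z^1_2(0)\otimes \mathrm{id}_1)]\!]=[\![(Z^2_1(0)\otimes \mathrm{id}_1)\circ(\mathrm{id}_1\otimes X^1_2(0))]\!]=\tfrac{1}{\sqrt2}\,\wedge X .$$ Placing the scalar diagram $X^1_0(0)\circ Z^0_1(0)$ next to the first of these diagrams gives a diagram whose interpretation is exactly $\wedge X$. 3. For every $n\ge 0$ and every unitary $U$ on $Q^n$ there is a ZX diagram $D:n\to n$ with $[\![D]\!]=U$ (exactly, including the global phase). -/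

import Mathlib

namespace ZX

noncomputable section

/-! ### Qubit spaces

`Q = ℂ²` has basis `|0⟩, |1⟩`, indexed by `Fin 2`. The space `Q^n = Q ⊗ ⋯ ⊗ Q` has the basis
`|x₀ ⋯ xₙ₋₁⟩` indexed by bit strings `x : Fin n → Fin 2`. A linear map `Q^m → Q^n` is
given by its matrix in these bases, with row index in the target. -/

/-- Index set of the computational basis of `Q^n`. -/
abbrev Bits (n : ℕ) : Type := Fin n → Fin 2

/-- Linear maps `Q^m → Q^n`, as matrices in the computational bases. -/
abbrev QMap (m n : ℕ) : Type := Matrix (Bits n) (Bits m) ℂ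

/-- `|0⟩`. -/
def ket0 : Fin 2 → ℂ := ![1, 0]

/-- `|1⟩`. -/
def ket1 : Fin 2 → ℂ := ![0, 1]

/-- `|+⟩ = (|0⟩ + |1⟩) / √2`. -/
def ketPlus : Fin 2 → ℂ := ((1 / Real.sqrt 2 : ℝ) : ℂ) • (ket0 + ket1)

/-- `|-⟩ = (|0⟩ - |1⟩) / √2`. -/
def ketMinus : Fin 2 → ℂ := ((1 / Real.sqrt 2 : ℝ) : ℂ) • (ket0 - ket1)

/-- The vector `v ⊗ ⋯ ⊗ v` (`n` factors) of `Q^n`; it is `1` for `n = 0`. -/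
def tensorPow (v : Fin 2 → ℂ) (n : ℕ) : Bits n → ℂ := fun x => ∏ i, v (x i)

/-- The operator `|v⟩⟨w|`. -/
def ketBra {m n : ℕ} (v : Bits n → ℂ) (w : Bits m → ℂ) : QMap m n :=
  Matrix.vecMulVec v (star w)

/-- The number `e^{iα}`. -/
def phase (α : Real.Angle) : ℂ := (α.toCircle : ℂ)

/-- The tensor product of linear maps, the first factor acting on the first wires. -/
def tensorMap {m n m' n' : ℕ} (A : QMap m n) (B : QMap m' n') : QMap (m + m') (n + n') :=
  Matrix.of fun y x =>
    A (fun i => y (Fin.castAdd n' i)) (fun j => x (Fin.castAdd m' j)) *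
      B (fun i => y (Fin.natAdd n i)) (fun j => x (Fin.natAdd m j))

/-! ### Gates -/

/-- The Hadamard gate. -/
def gateH : QMap 1 1 :=
  Matrix.of fun y x => (((1 / Real.sqrt 2 : ℝ) : ℂ) • !![1, 1; 1, -1]) (y 0) (x 0)

/-- The phase gate `Z_α`. -/
def gateZ (α : Real.Angle) : QMap 1 1 :=
  Matrix.of fun y x => (!![1, 0; 0, phase α]) (y 0) (x 0)

/-- The position of `|x₀ x₁⟩` in the list `|00⟩, |01⟩, |10⟩, |11⟩`. -/
def idx (x : Bits 2) : Fin 4 := finProdFinEquiv (x 0, x 1)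

/-- The controlled-NOT gate `∧X`, whose control is the first qubit. -/
def gateCNOT : QMap 2 2 :=
  Matrix.of fun y x =>
    (!![1, 0, 0, 0;
        0, 1, 0, 0;
        0, 0, 0, 1;
        0, 0, 1, 0]) (idx y) (idx x)

/-! ### Diagrams -/

/-- Diagrams of the ZX-calculus with `m` inputs and `n` outputs: everything that can be drawn
from `Z` spiders, `X` spiders and Hadamard vertices with plain wires (straight, crossing, or
bent), by plugging diagrams together and by juxtaposing them. These are the arrows `m → n` of
the free self-dual compact category on the three kinds of vertices, given by terms. Every open
graph with such vertices is presented by a term, and the interpretation below depends only on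
the graph that a term presents. -/
inductive Diagram : ℕ → ℕ → Type
  /-- The vertex `Z^m_n(α)` with `m` inputs and `n` outputs. -/
  | Z (m n : ℕ) (α : Real.Angle) : Diagram m n
  /-- The vertex `X^m_n(α)` with `m` inputs and `n` outputs. -/
  | X (m n : ℕ) (α : Real.Angle) : Diagram m n
  /-- The Hadamard vertex. -/
  | H : Diagram 1 1
  /-- `n` parallel wires. -/
  | id (n : ℕ) : Diagram n n
  /-- Two crossing wires. -/
  | swap : Diagram 2 2
  /-- A bent wire joining two outputs. -/
  | cup : Diagram 0 2
  /-- A bent wire joining two inputs. -/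
  | cap : Diagram 2 0
  /-- `comp g f` is `g ∘ f`: the outputs of `f` are plugged into the inputs of `g`. -/
  | comp {m k n : ℕ} (g : Diagram k n) (f : Diagram m k) : Diagram m n
  /-- `f` and `g` side by side, the wires of `f` first. -/
  | tensor {m n m' n' : ℕ} (f : Diagram m n) (g : Diagram m' n') : Diagram (m + m') (n + n')

/-- The spider of an orthonormal basis `a, b` of `Q`:
`a^{⊗m} ↦ a^{⊗n}`, `b^{⊗m} ↦ e^{iα} b^{⊗n}`, and all mixed products of `a` and `b` go to `0`;
that is `|a⋯a⟩⟨a⋯a| + e^{iα} |b⋯b⟩⟨b⋯b|` (a sum of two terms also when `m = 0`). -/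
def spiderMap (a b : Fin 2 → ℂ) (m n : ℕ) (α : Real.Angle) : QMap m n :=
  ketBra (tensorPow a n) (tensorPow a m) + phase α • ketBra (tensorPow b n) (tensorPow b m)

/-- The exchange `|x₀ x₁⟩ ↦ |x₁ x₀⟩`. -/
def swapMap : QMap 2 2 :=
  Matrix.of fun y x => if y 0 = x 1 ∧ y 1 = x 0 then 1 else 0

/-- The vector `|00⟩ + |11⟩`. -/
def cupMap : QMap 0 2 := Matrix.of fun y _ => if y 0 = y 1 then 1 else 0

/-- The functional `⟨00| + ⟨11|`. -/
def capMap : QMap 2 0 := Matrix.of fun _ x => if x 0 = x 1 then 1 else 0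

/-- The interpretation of diagrams as linear maps: the symmetric monoidal functor with the
prescribed values on the three kinds of vertices. -/
def Diagram.interp : {m n : ℕ} → Diagram m n → QMap m n
  | _, _, .Z m n α => spiderMap ket0 ket1 m n α
  | _, _, .X m n α => spiderMap ketPlus ketMinus m n α
  | _, _, .H => gateH
  | _, _, .id _ => 1
  | _, _, .swap => swapMap
  | _, _, .cup => cupMap
  | _, _, .cap => capMap
  | _, _, .comp g f => g.interp * f.interp
  | _, _, .tensor f g => tensorMap f.interp g.interp

/-- A `Z` vertex on the first wire joined by an edge to an `X` vertex on the second wire, the edge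
being an output of the `Z` vertex. -/
def cxDown : Diagram 2 2 :=
  .comp (k := 3) (.tensor (.id 1) (.X 2 1 0)) (.tensor (.Z 1 2 0) (.id 1))

/-- The same graph, the edge being an output of the `X` vertex. -/
def cxUp : Diagram 2 2 :=
  .comp (k := 3) (.tensor (.Z 2 1 0) (.id 1)) (.tensor (.id 1) (.X 1 2 0))

/-- A `Z` vertex and an `X` vertex joined by a single edge, without inputs and outputs. -/
def dumbbell : Diagram 0 0 := .comp (.X 1 0 0) (.Z 0 1 0)

end

end ZX

namespace ZX

open Matrix

/-! ### Entries of the spiders -/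

/-! The gate identities are entrywise computations: a phase-free `Z` spider copies basis states, and
a three-legged phase-free `X` spider is a parity check. Universality is proved for every linear map
(`realizable`). Writing the entries of `A` as a diagonal on `m + n` wires, with fresh wires created
on the right and the old ones summed away, reduces it to diagonal maps (`realizable_of_diagonal`).
These are closed under products, so it suffices to change a single diagonal entry of the identity
(`update_one_mem_realizableDiagonals`). That is done by summing over an auxiliary bit `a`: at `a =
0` the weight is `1`, at `a = 1` it is `c - 1` times the indicator of `x = b`, and this indicator is
a product of two-bit tests of `a` against each `x i`. A two-bit test is a one-qubit gate placed
between two wires; the gates needed are built from diagonal gates and Hadamards. Normalising factors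
are harmless because every complex scalar is realizable (`realizableScalar`). -/

theorem prod_ite_eq_one {n : ℕ} (x : Bits n) (b : Fin 2) :
    (∏ i, if x i = b then (1 : ℂ) else 0) = if x = fun _ => b then 1 else 0 := by
  rw [Finset.prod_ite_zero]
  simp [funext_iff]

theorem tensorPow_ket0 {n : ℕ} (x : Bits n) :
    tensorPow ket0 n x = if x = fun _ => 0 then 1 else 0 := by
  rw [← prod_ite_eq_one]
  refine Finset.prod_congr rfl fun i _ => ?_
  generalize x i = a
  fin_cases a <;> simp [ket0]

theorem tensorPow_ket1 {n : ℕ} (x : Bits n) :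
    tensorPow ket1 n x = if x = fun _ => 1 then 1 else 0 := by
  rw [← prod_ite_eq_one]
  refine Finset.prod_congr rfl fun i _ => ?_
  generalize x i = a
  fin_cases a <;> simp [ket1]

theorem spiderMap_apply (a b : Fin 2 → ℂ) {m n : ℕ} (α : Real.Angle) (y : Bits n) (x : Bits m) :
    spiderMap a b m n α y x =
      tensorPow a n y * star (tensorPow a m x) +
        phase α * (tensorPow b n y * star (tensorPow b m x)) :=
  rfl

theorem spiderMap_Z_apply {m n : ℕ} (α : Real.Angle) (y : Bits n) (x : Bits m) :
    spiderMap ket0 ket1 m n α y x =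
      (if (y = fun _ => 0) ∧ (x = fun _ => 0) then 1 else 0) +
        phase α * (if (y = fun _ => 1) ∧ (x = fun _ => 1) then 1 else 0) := by
  simp only [spiderMap_apply, tensorPow_ket0, tensorPow_ket1, ite_and, apply_ite star, star_one,
    star_zero, ite_mul, zero_mul, one_mul]

/-- The number `1 / √2`. -/
noncomputable def rsqrt : ℂ := ((1 / Real.sqrt 2 : ℝ) : ℂ)

theorem rsqrt_mul_self : rsqrt * rsqrt = 1 / 2 := by
  rw [rsqrt, ← Complex.ofReal_mul, div_mul_div_comm, Real.mul_self_sqrt (by norm_num)]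
  norm_num

theorem rsqrt_ne_zero : rsqrt ≠ 0 := by
  intro h
  simpa [h] using rsqrt_mul_self

theorem star_rsqrt : star rsqrt = rsqrt := Complex.conj_ofReal _

/-- The number `(-1)^b`. -/
def sgn (b : Fin 2) : ℂ := if b = 0 then 1 else -1

@[simp] theorem sgn_zero : sgn 0 = 1 := rfl

@[simp] theorem sgn_one : sgn 1 = -1 := rfl

theorem star_sgn (b : Fin 2) : star (sgn b) = sgn b := by
  fin_cases b <;> simp

theorem tensorPow_ketPlus {n : ℕ} (x : Bits n) : tensorPow ketPlus n x = rsqrt ^ n := by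
  rw [tensorPow, Finset.prod_eq_pow_card (b := rsqrt)] <;> simp
  intro i
  generalize x i = b
  fin_cases b <;> simp [ketPlus, ket0, ket1, rsqrt]

theorem tensorPow_ketMinus {n : ℕ} (x : Bits n) :
    tensorPow ketMinus n x = rsqrt ^ n * ∏ i, sgn (x i) := by
  have h (b : Fin 2) : ketMinus b = rsqrt * sgn b := by
    fin_cases b <;> simp [ketMinus, ket0, ket1, rsqrt]
  simp [tensorPow, h, Finset.prod_mul_distrib]

theorem spiderMap_X_apply {m n : ℕ} (α : Real.Angle) (y : Bits n) (x : Bits m) :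
    spiderMap ketPlus ketMinus m n α y x =
      rsqrt ^ (n + m) * (1 + phase α * ((∏ i, sgn (y i)) * ∏ j, sgn (x j))) := by
  simp only [spiderMap_apply, tensorPow_ketPlus, tensorPow_ketMinus, star_mul', star_pow,
    star_rsqrt, star_prod, star_sgn]
  ring

@[simp]
theorem phase_zero : phase 0 = 1 := by simp [phase]

theorem exists_phase_eq {u : ℂ} (hu : ‖u‖ = 1) : ∃ α : Real.Angle, phase α = u := by
  refine ⟨(u.arg : Real.Angle), ?_⟩
  have := Complex.norm_mul_exp_arg_mul_I u
  simpa [phase, hu, Circle.coe_exp] using this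

theorem interp_Z_one_one (α : Real.Angle) : (Diagram.Z 1 1 α).interp = gateZ α := by
  ext y x
  simp only [Diagram.interp, spiderMap_Z_apply, gateZ, of_apply, funext_iff, Fin.forall_fin_one]
  generalize y 0 = a
  generalize x 0 = b
  fin_cases a <;> fin_cases b <;> simp

/-! ### Tensor products in terms of concatenated bit strings -/

@[simp]
theorem tensorMap_append {m n m' n' : ℕ} (A : QMap m n) (B : QMap m' n') (y : Bits n)
    (y' : Bits n') (x : Bits m) (x' : Bits m') :
    tensorMap A B (Fin.append y y') (Fin.append x x') = A y x * B y' x' := by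
  simp [tensorMap]

theorem sum_bits_add {m n : ℕ} (f : Bits (m + n) → ℂ) :
    ∑ x, f x = ∑ x : Bits m, ∑ y : Bits n, f (Fin.append x y) := by
  rw [← (Fin.appendEquiv m n).sum_comp, Fintype.sum_prod_type]
  rfl

theorem exists_append {m n : ℕ} (x : Bits (m + n)) :
    ∃ (y : Bits m) (z : Bits n), x = Fin.append y z :=
  ⟨_, _, (Fin.append_castAdd_natAdd (f := x)).symm⟩

/-! ### The controlled-NOT gate -/

theorem append_ext_iff {m n : ℕ} {a c : Bits m} {b d : Bits n} :
    Fin.append a b = Fin.append c d ↔ a = c ∧ b = d := by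
  rw [← Prod.mk.injEq]
  exact (Fin.appendEquiv m n (α := Fin 2)).injective.eq_iff (a := (a, b)) (b := (c, d))

theorem gateCNOT_apply (y x : Bits 2) :
    gateCNOT y x = if y 0 = x 0 ∧ y 1 = x 0 + x 1 then 1 else 0 := by
  simp only [gateCNOT, idx, of_apply]
  generalize x 0 = a, x 1 = b, y 0 = c, y 1 = d
  fin_cases a <;> fin_cases b <;> fin_cases c <;> fin_cases d <;> rfl

/-- With a single nonzero intermediate string per column, the sum in a matrix product collapses. -/
theorem tensorMap_Z_one_two_id :
    tensorMap (spiderMap ket0 ket1 1 2 0) (1 : QMap 1 1) =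
      of fun z x => if z = ![x 0, x 0, x 1] then 1 else 0 := by
  ext z x
  simp [tensorMap, spiderMap_Z_apply, Matrix.one_apply, funext_iff, Fin.forall_fin_succ]
  generalize x 0 = a, x 1 = b, z 0 = c, z 1 = d, z 2 = e
  fin_cases a <;> fin_cases c <;> fin_cases d <;> simp

theorem tensorMap_Z_two_one_id :
    tensorMap (spiderMap ket0 ket1 2 1 0) (1 : QMap 1 1) =
      of fun y z => if z = ![y 0, y 0, y 1] then 1 else 0 := by
  ext y z
  simp [tensorMap, spiderMap_Z_apply, Matrix.one_apply, funext_iff, Fin.forall_fin_succ]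
  generalize y 0 = a, y 1 = b, z 0 = c, z 1 = d, z 2 = e
  fin_cases a <;> fin_cases c <;> fin_cases d <;> simp [eq_comm]

/-- `sgn` is a character of `ℤ/2`, so half of one plus the product of signs is the indicator of even
parity. -/
theorem half_one_add_sgn (a b c : Fin 2) :
    rsqrt ^ 3 * (1 + sgn a * (sgn b * sgn c)) = rsqrt * if a = b + c then 1 else 0 := by
  have h := rsqrt_mul_self
  fin_cases a <;> fin_cases b <;> fin_cases c <;> simp <;> linear_combination 2 * rsqrt * h

theorem interp_cxDown : cxDown.interp = rsqrt • gateCNOT := by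
  ext y x
  change (tensorMap (1 : QMap 1 1) (spiderMap ketPlus ketMinus 2 1 0) *
    tensorMap (spiderMap ket0 ket1 1 2 0) (1 : QMap 1 1)) y x = _
  rw [tensorMap_Z_one_two_id, mul_apply]
  simp only [of_apply, mul_ite, mul_one, mul_zero, Finset.sum_ite_eq',
    Finset.mem_univ, if_true]
  simp [tensorMap, spiderMap_X_apply, Matrix.one_apply, funext_iff, gateCNOT_apply,
    half_one_add_sgn]
  by_cases h₀ : y 0 = x 0 <;> by_cases h₁ : y 1 = x 0 + x 1 <;> simp [h₀, h₁]

theorem interp_cxUp : cxUp.interp = rsqrt • gateCNOT := by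
  ext y x
  change (tensorMap (spiderMap ket0 ket1 2 1 0) (1 : QMap 1 1) *
    tensorMap (1 : QMap 1 1) (spiderMap ketPlus ketMinus 1 2 0)) y x = _
  rw [tensorMap_Z_two_one_id, mul_apply]
  simp only [of_apply, ite_mul, one_mul, zero_mul, Finset.sum_ite_eq',
    Finset.mem_univ, if_true]
  simp [tensorMap, spiderMap_X_apply, Matrix.one_apply, funext_iff, gateCNOT_apply, ite_and]
  have h := rsqrt_mul_self
  generalize x 0 = a, x 1 = b, y 0 = c, y 1 = d
  fin_cases a <;> fin_cases b <;> fin_cases c <;> fin_cases d <;> simp <;>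
    linear_combination 2 * rsqrt * h

theorem tensorMap_scalar {m n : ℕ} (A : QMap m n) (c : QMap 0 0) :
    tensorMap A c = c ![] ![] • A := by
  ext y x
  change A y x * c _ _ = c _ _ * A y x
  rw [mul_comm]
  congr 2 <;> exact Subsingleton.elim _ _

/-- The value is `√2`: the functional `⟨+| + ⟨-|` equals `√2 ⟨0|`, applied to `|0⟩ + |1⟩`. -/
theorem interp_dumbbell : dumbbell.interp ![] ![] = rsqrt⁻¹ := by
  change (spiderMap ketPlus ketMinus 1 0 0 * spiderMap ket0 ket1 0 1 0) ![] ![] = _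
  have h := rsqrt_mul_self
  have h0 := rsqrt_ne_zero
  rw [mul_apply]
  simp only [spiderMap_X_apply, spiderMap_Z_apply]
  rw [← (Equiv.funUnique (Fin 1) (Fin 2)).symm.sum_comp]
  simp [Fin.sum_univ_two, funext_iff]
  field_simp
  linear_combination 2 * h

theorem interp_tensor_cxDown_dumbbell : (Diagram.tensor cxDown dumbbell).interp = gateCNOT := by
  change tensorMap cxDown.interp dumbbell.interp = _
  rw [tensorMap_scalar, interp_dumbbell, interp_cxDown, smul_smul,
    inv_mul_cancel₀ rsqrt_ne_zero, one_smul]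

/-! ### Linear maps that are represented by a diagram -/

/-- A linear map is realizable if it is the interpretation of some diagram. -/
def Realizable {m n : ℕ} (A : QMap m n) : Prop := ∃ D : Diagram m n, D.interp = A

theorem Realizable.mul {m k n : ℕ} {A : QMap k n} {B : QMap m k} (hA : Realizable A)
    (hB : Realizable B) : Realizable (A * B) := by
  obtain ⟨D, rfl⟩ := hA
  obtain ⟨E, rfl⟩ := hB
  exact ⟨.comp D E, rfl⟩

theorem Realizable.tensor {m n m' n' : ℕ} {A : QMap m n} {B : QMap m' n'} (hA : Realizable A)
    (hB : Realizable B) : Realizable (tensorMap A B) := by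
  obtain ⟨D, rfl⟩ := hA
  obtain ⟨E, rfl⟩ := hB
  exact ⟨.tensor D E, rfl⟩

theorem realizable_one (n : ℕ) : Realizable (1 : QMap n n) := ⟨.id n, rfl⟩

/-- Needed because `0 + n` and `n` are not definitionally equal. -/
theorem Realizable.cast {m n n' : ℕ} (h : n' = n) {A : QMap m n'} (hA : Realizable A) :
    Realizable (A.submatrix (fun y : Bits n => y ∘ Fin.cast h) id : QMap m n) := by
  subst h
  exact hA

/-! ### Scalars -/

/-- The scalar `c` as an endomorphism of `Q^0`. -/
def scalarMap (c : ℂ) : QMap 0 0 := of fun _ _ => c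

/-- A scalar is realizable if it is the value of a diagram without inputs and outputs. -/
def RealizableScalar (c : ℂ) : Prop := Realizable (scalarMap c)

theorem RealizableScalar.mul {c d : ℂ} (hc : RealizableScalar c) (hd : RealizableScalar d) :
    RealizableScalar (c * d) := by
  have := Realizable.mul hc hd
  have h : scalarMap c * scalarMap d = scalarMap (c * d) := by
    ext y x
    simp [scalarMap, mul_apply]
  rwa [h] at this

theorem realizableScalar_one_add_unit {u : ℂ} (hu : ‖u‖ = 1) : RealizableScalar (1 + u) := by
  obtain ⟨α, rfl⟩ := exists_phase_eq hu
  refine ⟨.Z 0 0 α, ?_⟩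
  ext y x
  simp [Diagram.interp, spiderMap_apply, tensorPow, scalarMap]

theorem realizableScalar_of_mem_Icc {r : ℝ} (h₀ : 0 ≤ r) (h₁ : r ≤ 4) :
    RealizableScalar r := by
  -- The angle is chosen so that `(1 + e^{iθ})(1 + e^{-iθ}) = 2 + 2 cos θ = r`.
  have hc : Real.cos (Real.arccos (r / 2 - 1)) = r / 2 - 1 :=
    Real.cos_arccos (by linarith) (by linarith)
  set θ := Real.arccos (r / 2 - 1)
  have h (t : ℝ) : ‖Complex.exp (t * Complex.I)‖ = 1 := Complex.norm_exp_ofReal_mul_I t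
  have := (realizableScalar_one_add_unit (h θ)).mul (realizableScalar_one_add_unit (h (-θ)))
  convert this using 1
  have h1 : Complex.exp (θ * Complex.I) * Complex.exp ((-θ : ℝ) * Complex.I) = 1 := by
    rw [← Complex.exp_add]; simp
  have h2 : Complex.exp (θ * Complex.I) + Complex.exp ((-θ : ℝ) * Complex.I) = r - 2 := by
    have := congrArg (fun x : ℝ => (2 * x : ℂ)) hc
    simp only [Complex.ofReal_cos, Complex.two_cos] at this
    push_cast at this ⊢
    linear_combination this
  linear_combination -h1 - h2

theorem realizableScalar_of_nonneg {r : ℝ} (hr : 0 ≤ r) : RealizableScalar r := by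
  obtain ⟨n, hn⟩ := pow_unbounded_of_one_lt r (by norm_num : (1 : ℝ) < 4)
  induction n generalizing r with
  | zero => exact realizableScalar_of_mem_Icc hr (by linarith [pow_zero (4 : ℝ)])
  | succ n ih =>
    have := (ih (r := r / 4) (by positivity) (by rw [pow_succ] at hn; linarith)).mul
      (realizableScalar_of_mem_Icc (r := 4) (by norm_num) le_rfl)
    convert this using 1
    push_cast
    ring

theorem realizableScalar_unit {u : ℂ} (hu : ‖u‖ = 1) : RealizableScalar u := by
  have key {v : ℂ} (hv : ‖v‖ = 1) (h : 1 + v ≠ 0) : RealizableScalar v := by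
    have h1 := realizableScalar_one_add_unit hv
    -- For a unit `v ≠ -1`, `1 + v = v * conj (1 + v)`, hence `v = (1 + v)² / ‖1 + v‖²`. The
    -- excluded value `-1` is obtained below as `I * I`.
    have h2 := (h1.mul h1).mul (realizableScalar_of_nonneg (r := (‖1 + v‖ ^ 2)⁻¹) (by positivity))
    convert h2 using 1
    have hc := Complex.mul_conj' v
    rw [hv] at hc
    have hd := Complex.mul_conj' (1 + v)
    simp only [map_add, map_one] at hd
    have h0 : ((‖1 + v‖ : ℝ) : ℂ) ≠ 0 := by simpa using h
    push_cast
    field_simp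
    push_cast at hc
    linear_combination (-v) * hd + (1 + v) * hc
  by_cases h : 1 + u = 0
  · have hI : RealizableScalar Complex.I := key (by simp) fun h => by
      simpa using congrArg Complex.im h
    convert hI.mul hI using 1
    rw [Complex.I_mul_I]
    linear_combination h
  · exact key hu h

theorem realizableScalar (c : ℂ) : RealizableScalar c := by
  by_cases h : c = 0
  · simpa [h] using realizableScalar_of_nonneg le_rfl
  · have h0 : ((‖c‖ : ℝ) : ℂ) ≠ 0 := by simpa using h
    have := (realizableScalar_of_nonneg (norm_nonneg c)).mul
      (realizableScalar_unit (u := c / ‖c‖) (by simp [h]))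
    rwa [mul_div_cancel₀ _ h0] at this

theorem Realizable.smul {m n : ℕ} {A : QMap m n} (hA : Realizable A) (c : ℂ) :
    Realizable (c • A) := by
  have := hA.tensor (realizableScalar c)
  rwa [tensorMap_scalar] at this

theorem Realizable.of_smul {m n : ℕ} {A : QMap m n} {c : ℂ} (hc : c ≠ 0)
    (hA : Realizable (c • A)) : Realizable A := by
  simpa [smul_smul, hc] using hA.smul c⁻¹

/-! ### One-qubit maps -/

/-- The linear map `Q → Q` with the given matrix. -/
def gate (M : Matrix (Fin 2) (Fin 2) ℂ) : QMap 1 1 := M.submatrix (· 0) (· 0)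

theorem gate_mul (M N : Matrix (Fin 2) (Fin 2) ℂ) : gate M * gate N = gate (M * N) := by
  ext y x
  simp only [gate, mul_apply, submatrix_apply]
  exact (Equiv.funUnique (Fin 1) (Fin 2)).sum_comp fun j => M (y 0) j * N j (x 0)

theorem gate_smul (c : ℂ) (M : Matrix (Fin 2) (Fin 2) ℂ) : gate (c • M) = c • gate M := rfl

theorem realizable_ket_imaginary (r : ℝ) :
    Realizable (of fun y _ => ![1, r * Complex.I] (y 0) : QMap 0 1) := by
  have hr : (1 + r * Complex.I : ℂ) ≠ 0 := fun h => by
    simpa using congrArg Complex.re h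
  -- `X^0_1(α)` has entries proportional to `1 + u` and `1 - u` with `u = e^{iα}`; this Cayley
  -- transform solves `(1 - u) / (1 + u) = r * I`.
  obtain ⟨α, hα⟩ := exists_phase_eq (u := (1 - r * Complex.I) / (1 + r * Complex.I)) (by
    rw [norm_div, div_eq_one_iff_eq (by simpa using hr), ← Complex.norm_conj]
    simp [sub_eq_add_neg])
  have hs := rsqrt_ne_zero
  refine Realizable.of_smul (c := 2 * rsqrt / (1 + r * Complex.I))
    (div_ne_zero (mul_ne_zero two_ne_zero hs) hr)
    ⟨.X 0 1 α, ?_⟩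
  ext y x
  simp only [Diagram.interp, spiderMap_X_apply, hα]
  simp
  generalize y 0 = b
  fin_cases b <;> simp <;> field_simp <;> ring

theorem realizable_gate_diagonal_phase {u : ℂ} (hu : ‖u‖ = 1) :
    Realizable (gate !![1, 0; 0, u]) := by
  obtain ⟨α, rfl⟩ := exists_phase_eq hu
  exact ⟨.Z 1 1 α, interp_Z_one_one α⟩

theorem sum_bits_one (f : Bits 1 → ℂ) : ∑ x, f x = f ![0] + f ![1] := by
  rw [← Fin.sum_univ_two fun b => f ![b], ← (Equiv.funUnique (Fin 1) (Fin 2)).symm.sum_comp]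
  refine Finset.sum_congr rfl fun b _ => congrArg f ?_
  ext i
  fin_cases i
  rfl

theorem bits_one_eq (x : Bits 1) : x = ![x 0] := by
  ext i
  fin_cases i
  rfl

theorem append_one_one (a b : Fin 2) : Fin.append ![a] ![b] = ![a, b] := by
  ext i
  fin_cases i <;> rfl

theorem append_one_zero (a : Fin 2) : Fin.append ![a] (![] : Bits 0) = ![a] := by
  ext i
  fin_cases i
  rfl

/-- The spider `Z^2_1(0)` multiplies vectors pointwise, so plugging a ket into one leg gives the
diagonal gate of its coordinates. -/
theorem realizable_gate_diagonal_of_ket {c : ℂ}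
    (h : Realizable (of fun y _ => ![1, c] (y 0) : QMap 0 1)) :
    Realizable (gate !![1, 0; 0, c]) := by
  have := Realizable.mul ⟨.Z 2 1 0, rfl⟩ ((realizable_one 1).tensor h)
  convert this
  ext y x
  rw [mul_apply, sum_bits_add (m := 1) (n := 1), bits_one_eq x, ← append_one_zero]
  simp_rw [tensorMap_append, Diagram.interp, spiderMap_Z_apply, Matrix.one_apply, sum_bits_one,
    append_one_one, append_one_zero]
  generalize x 0 = a
  rw [bits_one_eq y]
  generalize y 0 = b
  fin_cases a <;> fin_cases b <;> simp [funext_iff, gate]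

theorem gate_diagonal_mul (p q p' q' : ℂ) :
    gate !![p, 0; 0, q] * gate !![p', 0; 0, q'] = gate !![p * p', 0; 0, q * q'] := by
  rw [gate_mul]
  simp

theorem realizable_gate_diagonal {p q : ℂ} (hp : p ≠ 0) : Realizable (gate !![p, 0; 0, q]) := by
  set c := q / p with hc
  have h1 := realizable_gate_diagonal_of_ket (realizable_ket_imaginary ‖c‖)
  -- The ket supplies `‖c‖ * I`; this phase cancels the `I` and restores the argument of `c`.
  have h2 := realizable_gate_diagonal_phase (u := -Complex.I * Complex.exp (c.arg * Complex.I))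
    (by rw [norm_mul, Complex.norm_exp_ofReal_mul_I]; simp)
  have h3 := (h1.mul h2).smul p
  rw [gate_diagonal_mul, ← gate_smul] at h3
  convert h3 using 2
  have h4 : ‖c‖ * Complex.I * (-Complex.I * Complex.exp (c.arg * Complex.I)) = c := by
    rw [← mul_assoc, mul_assoc (‖c‖ : ℂ), mul_neg, Complex.I_mul_I, neg_neg, mul_one,
      Complex.norm_mul_exp_arg_mul_I]
  rw [h4, hc]
  simp [mul_div_cancel₀ q hp]

theorem realizable_gate_hadamard : Realizable (gate !![1, 1; 1, -1]) :=
  Realizable.of_smul rsqrt_ne_zero ⟨.H, rfl⟩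

/-- Hadamard conjugation diagonalises a circulant, with eigenvalues `a + b` and `a - b`. -/
theorem realizable_gate_circulant {a b : ℂ} (h : a + b ≠ 0) : Realizable (gate !![a, b; b, a]) := by
  have := (realizable_gate_hadamard.mul (realizable_gate_diagonal (q := a - b) h)).mul
    realizable_gate_hadamard
  rw [gate_mul, gate_mul] at this
  refine Realizable.of_smul (c := 2) two_ne_zero ?_
  rw [← gate_smul]
  convert this using 2
  ext i j
  fin_cases i <;> fin_cases j <;> simp <;> ring

theorem realizable_gate_upper : Realizable (gate !![1, 1; 0, 1]) := by
  -- The entry `-2 / 3` kills the lower left corner, leaving `!![-3, 5/3; 0, 16/3]`; the outer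
  -- diagonal gates rescale the other entries to `1`.
  have hS := ((realizable_gate_circulant (a := 1) (b := 2) (by norm_num)).mul
    (realizable_gate_diagonal (p := 1) (q := -2 / 3) one_ne_zero)).mul
    (realizable_gate_circulant (a := 1) (b := 3) (by norm_num))
  have := ((realizable_gate_diagonal (p := -1 / 3) (q := -5 / 48) (by norm_num)).mul hS).mul
    (realizable_gate_diagonal (p := 1) (q := -9 / 5) one_ne_zero)
  simp only [gate_mul] at this
  convert this using 2
  ext i j
  fin_cases i <;> fin_cases j <;> simp <;> norm_num

/-- The map sending `|y⟩` to `|0⟩ + |1⟩` if `y = b`, and to `|0⟩` otherwise, is realizable. -/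
theorem realizable_gate_test (b : Fin 2) :
    Realizable (gate (of fun z y => if z = 1 ∧ y ≠ b then 0 else 1)) := by
  have h : gate (of fun z y => if z = 1 ∧ y ≠ 1 then 0 else 1) = gate !![1, 1; 0, 1] := by
    congr 1
    ext i j
    fin_cases i <;> fin_cases j <;> simp
  have h' : gate (of fun z y => if z = 1 ∧ y ≠ 0 then 0 else 1) =
      gate !![1, 1; 0, 1] * gate !![0, 1; 1, 0] := by
    rw [gate_mul]
    congr 1
    ext i j
    fin_cases i <;> fin_cases j <;> simp
  fin_cases b
  · exact h' ▸ realizable_gate_upper.mul (realizable_gate_circulant (by norm_num))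
  · exact h ▸ realizable_gate_upper

/-! ### Diagonal maps -/

theorem realizable_allOnes (m n : ℕ) : Realizable (of fun _ _ => 1 : QMap m n) := by
  have h₀ : Realizable (of fun _ _ => 1 : QMap 0 0) := realizableScalar 1
  have h₁ : Realizable (of fun _ _ => 1 : QMap 0 1) := by
    refine ⟨.Z 0 1 0, ?_⟩
    ext y x
    rw [Diagram.interp, spiderMap_Z_apply, bits_one_eq y]
    generalize y 0 = b
    fin_cases b <;> simp [funext_iff]
  have h₂ : Realizable (of fun _ _ => 1 : QMap 1 0) := by
    refine ⟨.Z 1 0 0, ?_⟩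
    ext y x
    rw [Diagram.interp, spiderMap_Z_apply, bits_one_eq x]
    generalize x 0 = b
    fin_cases b <;> simp [funext_iff]
  have h {m n m' n' : ℕ} : tensorMap (of fun _ _ => 1 : QMap m n) (of fun _ _ => 1 : QMap m' n') =
      of fun _ _ => 1 := by
    ext y x
    simp [tensorMap]
  induction m with
  | zero =>
    induction n with
    | zero => exact h₀
    | succ n ih =>
      have := ih.tensor h₁
      rwa [h] at this
  | succ m ih =>
    have := ih.tensor h₂
    rwa [h] at this

/-- The functions on bit strings whose diagonal matrix is realizable. -/
def realizableDiagonals (n : ℕ) : Submonoid (Bits n → ℂ) where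
  carrier := {f | Realizable (diagonal f)}
  one_mem' := by
    simpa using realizable_one n
  mul_mem' {f g} hf hg := by
    have := Realizable.mul hf hg
    rwa [diagonal_mul_diagonal] at this

theorem mem_realizableDiagonals {n : ℕ} {f : Bits n → ℂ} :
    f ∈ realizableDiagonals n ↔ Realizable (diagonal f) := Iff.rfl

theorem qmap_ext_append {m n m' n' : ℕ} {A B : QMap (m + m') (n + n')}
    (h : ∀ y y' x x', A (Fin.append y y') (Fin.append x x') = B (Fin.append y y') (Fin.append x x')) :
    A = B := by
  ext y x
  obtain ⟨y, y', rfl⟩ := exists_append y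
  obtain ⟨x, x', rfl⟩ := exists_append x
  exact h _ _ _ _

theorem mem_realizableDiagonals_append_left {m n : ℕ} {f : Bits m → ℂ}
    (hf : f ∈ realizableDiagonals m) {g : Bits (m + n) → ℂ}
    (hg : ∀ x y, g (Fin.append x y) = f x) : g ∈ realizableDiagonals (m + n) := by
  have := Realizable.tensor hf (realizable_one n)
  rw [mem_realizableDiagonals]
  convert this
  refine qmap_ext_append fun y y' x x' => ?_
  simp only [diagonal_apply, tensorMap_append, append_ext_iff, hg, Matrix.one_apply, ite_and,
    mul_ite, mul_one, mul_zero]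
  split_ifs <;> rfl

theorem mem_realizableDiagonals_append_right {m n : ℕ} {f : Bits n → ℂ}
    (hf : f ∈ realizableDiagonals n) {g : Bits (m + n) → ℂ}
    (hg : ∀ x y, g (Fin.append x y) = f y) : g ∈ realizableDiagonals (m + n) := by
  have := Realizable.tensor (realizable_one m) hf
  rw [mem_realizableDiagonals]
  convert this
  refine qmap_ext_append fun y y' x x' => ?_
  simp only [diagonal_apply, tensorMap_append, append_ext_iff, hg, Matrix.one_apply, ite_and,
    ite_mul, one_mul, zero_mul]

/-- The map `|x⟩ ↦ ∑ y, |x⟩|y⟩`. -/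
def createRight (m n : ℕ) : QMap m (m + n) :=
  of fun z x => if (fun i => z (Fin.castAdd n i)) = x then 1 else 0

/-- The map `|x⟩|y⟩ ↦ |x⟩`. -/
def discardRight (m n : ℕ) : QMap (m + n) m :=
  of fun y z => if y = fun i => z (Fin.castAdd n i) then 1 else 0

/-- The map `|x⟩|y⟩ ↦ |y⟩`. -/
def discardLeft (m n : ℕ) : QMap (m + n) n :=
  of fun y z => if y = fun i => z (Fin.natAdd m i) then 1 else 0

theorem realizable_createRight (m n : ℕ) : Realizable (createRight m n) := by
  have h : tensorMap (1 : QMap m m) (of fun _ _ => 1 : QMap 0 n) = createRight m n := by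
    ext y x
    simp [tensorMap, createRight, Matrix.one_apply]
  exact h ▸ (realizable_one m).tensor (realizable_allOnes 0 n)

theorem realizable_discardRight (m n : ℕ) : Realizable (discardRight m n) := by
  have h : tensorMap (1 : QMap m m) (of fun _ _ => 1 : QMap n 0) = discardRight m n := by
    ext y x
    simp [tensorMap, discardRight, Matrix.one_apply]
  exact h ▸ (realizable_one m).tensor (realizable_allOnes n 0)

theorem realizable_discardLeft (m n : ℕ) : Realizable (discardLeft m n) := by
  have h : (tensorMap (of fun _ _ => 1 : QMap m 0) (1 : QMap n n)).submatrix
      (fun y : Bits n => y ∘ Fin.cast (Nat.zero_add n)) id = discardLeft m n := by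
    ext y x
    simp [tensorMap, discardLeft, Matrix.one_apply]
  exact h ▸ ((realizable_allOnes m 0).tensor (realizable_one n)).cast _

/-- Fresh wires start in the all-ones vector and end in the all-ones functional, which sums over
their values. -/
theorem sum_mem_realizableDiagonals {m n : ℕ} {f : Bits (m + n) → ℂ}
    (hf : f ∈ realizableDiagonals (m + n)) {g : Bits m → ℂ}
    (hg : ∀ x, g x = ∑ y, f (Fin.append x y)) : g ∈ realizableDiagonals m := by
  have := ((realizable_discardRight m n).mul hf).mul (realizable_createRight m n)
  rw [mem_realizableDiagonals]
  convert this
  ext y x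
  rw [mul_apply, sum_bits_add]
  simp_rw [mul_diagonal, discardRight, createRight, of_apply, Fin.append_left, diagonal_apply, hg]
  by_cases h : y = x <;> simp [h]

theorem swapMap_apply (y x : Bits 2) : swapMap y x = if y = ![x 1, x 0] then 1 else 0 := by
  simp [swapMap, funext_iff]

theorem mem_realizableDiagonals_swap {n : ℕ} {f g : Bits (n + 2) → ℂ}
    (hf : f ∈ realizableDiagonals (n + 2))
    (hg : ∀ x a b, g (Fin.append x ![a, b]) = f (Fin.append x ![b, a])) :
    g ∈ realizableDiagonals (n + 2) := by
  have hs : Realizable (tensorMap (1 : QMap n n) swapMap) :=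
    (realizable_one n).tensor ⟨.swap, rfl⟩
  have := (hs.mul hf).mul hs
  rw [mem_realizableDiagonals]
  convert this
  refine qmap_ext_append fun y y' x x' => ?_
  rw [mul_apply, sum_bits_add]
  have hx : x' = ![x' 0, x' 1] := by ext i; fin_cases i <;> rfl
  rw [hx]
  simp only [mul_diagonal, tensorMap_append, Matrix.one_apply, diagonal_apply, append_ext_iff,
    swapMap_apply]
  by_cases h : y = x <;> by_cases h' : y' = ![x' 0, x' 1] <;> simp [h, h', hg]

theorem realizable_of_diagonal {m n : ℕ} (h : ∀ f, f ∈ realizableDiagonals (m + n))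
    (A : QMap m n) : Realizable A := by
  -- Only the string `x` followed by `y` contributes to the entry at `(y, x)`.
  have := ((realizable_discardLeft m n).mul
    (h fun z => A (fun i => z (Fin.natAdd m i)) (fun i => z (Fin.castAdd n i)))).mul
    (realizable_createRight m n)
  convert this
  ext y x
  rw [mul_apply, sum_bits_add]
  simp [mul_diagonal, discardLeft, createRight]

theorem tensorMap_id_Z_two_one :
    tensorMap (1 : QMap 1 1) (spiderMap ket0 ket1 2 1 0) =
      of fun y z => if z = ![y 0, y 1, y 1] then 1 else 0 := by
  ext y z
  simp [tensorMap, spiderMap_Z_apply, Matrix.one_apply, funext_iff, Fin.forall_fin_succ]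
  generalize y 0 = a, y 1 = b, z 0 = c, z 1 = d, z 2 = e
  fin_cases b <;> fin_cases d <;> fin_cases e <;> simp [eq_comm]

/-- A one-qubit gate between two wires. -/
theorem mem_realizableDiagonals_of_gate {M : Matrix (Fin 2) (Fin 2) ℂ} (hM : Realizable (gate M)) :
    (fun x => M (x 1) (x 0)) ∈ realizableDiagonals 2 := by
  have h₁ : Realizable (tensorMap (1 : QMap 1 1) (spiderMap ket0 ket1 2 1 0)) :=
    (realizable_one 1).tensor ⟨.Z 2 1 0, rfl⟩
  have h₂ : Realizable (tensorMap (spiderMap ket0 ket1 1 2 0) (1 : QMap 1 1)) :=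
    Realizable.tensor ⟨.Z 1 2 0, rfl⟩ (realizable_one 1)
  -- The first wire is copied, the copy goes through `M`, and the result is merged with the second
  -- wire, forcing equality and leaving the weight `M (x 1) (x 0)`.
  have := (h₁.mul (((realizable_one 1).tensor hM).tensor (realizable_one 1))).mul h₂
  rw [mem_realizableDiagonals]
  convert this
  ext y x
  rw [tensorMap_id_Z_two_one, tensorMap_Z_one_two_id, mul_apply]
  simp only [mul_apply, of_apply, mul_ite, mul_one, mul_zero, ite_mul, one_mul, zero_mul,
    Finset.sum_ite_eq', Finset.mem_univ, if_true, diagonal_apply]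
  simp [tensorMap, Matrix.one_apply, funext_iff, gate, Fin.forall_fin_succ]
  by_cases h₀ : y 0 = x 0 <;> by_cases h₁ : y 1 = x 1 <;> simp [h₀, h₁]

theorem append_append_one {n : ℕ} (x : Bits n) (a b : Fin 2) :
    Fin.append (Fin.append x ![a]) ![b] = Fin.append x ![a, b] := by
  rw [Fin.append_assoc, append_one_one]
  rfl

theorem match_mem_realizableDiagonals {n : ℕ} (b : Bits n) {g : Bits (n + 1) → ℂ}
    (hg : ∀ x a, g (Fin.append x ![a]) = if a = 1 ∧ x ≠ b then 0 else 1) :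
    g ∈ realizableDiagonals (n + 1) := by
  induction n with
  | zero =>
    convert one_mem (realizableDiagonals 1)
    ext x
    obtain ⟨y, z, rfl⟩ := exists_append (m := 0) (n := 1) x
    rw [bits_one_eq z, hg]
    simp [Subsingleton.elim y b]
  | succ n ih =>
    obtain ⟨b, b', rfl⟩ := exists_append (m := n) (n := 1) b
    let f : Bits (n + 1) → ℂ := fun x =>
      if x (Fin.natAdd n 0) = 1 ∧ (fun i => x (Fin.castAdd 1 i)) ≠ b then 0 else 1
    have hf : f ∈ realizableDiagonals (n + 1) := ih b fun x a => by simp [f]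
    -- The indicator for `n` bits reads `x, a`. A wire is added after `a` and swapped with it,
    -- keeping `a` last; `h₃` tests the new bit against `a`.
    have h₁ := mem_realizableDiagonals_append_left (n := 1) hf
      (g := fun x => f (fun i => x (Fin.castAdd 1 i))) fun x y => by simp
    have h₂ := mem_realizableDiagonals_swap (n := n) h₁
      (g := fun x => f (Fin.append (fun i => x (Fin.castAdd 2 i)) ![x (Fin.natAdd n 1)]))
      fun x a b => by
        rw [← append_append_one x b a]
        simp
    have h₃ := mem_realizableDiagonals_append_right (m := n)
      (mem_realizableDiagonals_of_gate (realizable_gate_test (b' 0)))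
      (g := fun x => if x (Fin.natAdd n 1) = 1 ∧ x (Fin.natAdd n 0) ≠ b' 0 then 0 else 1)
      fun x y => by simp
    convert mul_mem h₂ h₃ using 1
    ext z
    obtain ⟨x, a, rfl⟩ := exists_append (m := n + 1) (n := 1) z
    obtain ⟨x, y, rfl⟩ := exists_append (m := n) (n := 1) x
    rw [bits_one_eq a, hg, bits_one_eq y, append_append_one, bits_one_eq b']
    simp only [f, Pi.mul_apply, Fin.append_left, Fin.append_right, Ne, append_ext_iff]
    by_cases h : x = b <;> by_cases h' : y 0 = b' 0 <;> by_cases h'' : a 0 = 1 <;>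
      simp [h, h', h'']

theorem update_one_mem_realizableDiagonals {n : ℕ} (b : Bits n) (c : ℂ) :
    Function.update (1 : Bits n → ℂ) b c ∈ realizableDiagonals n := by
  let f : Bits (n + 1) → ℂ := fun x =>
    if x (Fin.natAdd n 0) = 1 ∧ (fun i => x (Fin.castAdd 1 i)) ≠ b then 0 else 1
  have hf : f ∈ realizableDiagonals (n + 1) := match_mem_realizableDiagonals b fun x a => by
    simp [f]
  have hc : (fun x => ![1, c - 1] (x 0)) ∈ realizableDiagonals 1 := by
    rw [mem_realizableDiagonals]
    convert realizable_gate_diagonal (p := 1) (q := c - 1) one_ne_zero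
    ext y x
    rw [bits_one_eq y, bits_one_eq x]
    generalize y 0 = a, x 0 = b
    fin_cases a <;> fin_cases b <;> simp [gate]
  refine sum_mem_realizableDiagonals (mul_mem hf (mem_realizableDiagonals_append_right hc
    (g := fun x => ![1, c - 1] (x (Fin.natAdd n 0))) fun x y => by simp)) fun x => ?_
  rw [sum_bits_one]
  by_cases h : x = b <;> simp [h, f]

theorem all_mem_realizableDiagonals {n : ℕ} (f : Bits n → ℂ) : f ∈ realizableDiagonals n := by
  have : f = ∏ b, Function.update (1 : Bits n → ℂ) b (f b) := by
    ext x
    simp [Finset.prod_apply, Function.update_apply]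
  rw [this]
  exact prod_mem fun b _ => update_one_mem_realizableDiagonals b (f b)

theorem realizable {m n : ℕ} (A : QMap m n) : Realizable A :=
  realizable_of_diagonal all_mem_realizableDiagonals A

end ZX

theorem mainTheorem9 :
    ZX.Diagram.H.interp = ZX.gateH ∧
    (∀ α : Real.Angle, (ZX.Diagram.Z 1 1 α).interp = ZX.gateZ α) ∧
    ZX.cxDown.interp = ((1 / Real.sqrt 2 : ℝ) : ℂ) • ZX.gateCNOT ∧
    ZX.cxUp.interp = ((1 / Real.sqrt 2 : ℝ) : ℂ) • ZX.gateCNOT ∧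
    (ZX.Diagram.tensor ZX.cxDown ZX.dumbbell).interp = ZX.gateCNOT ∧
    (∀ (n : ℕ) (U : Matrix (ZX.Bits n) (ZX.Bits n) ℂ),
      U ∈ Matrix.unitaryGroup (ZX.Bits n) ℂ → ∃ D : ZX.Diagram n n, D.interp = U) :=
  ⟨rfl, ZX.interp_Z_one_one, ZX.interp_cxDown, ZX.interp_cxUp,
    ZX.interp_tensor_cxDown_dumbbell, fun _ U _ => ZX.realizable U⟩
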